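/- Let $\mathcal S$ and $\mathcal A$ be finite sets, $|\mathcal A|\ge 2$, and consider a finite Markov decision process with transition probabilities $P(\cdot\mid s,a)\in\Delta(\mathcal S)$, rewards $r(s,a)\in[0,1]$ and discount factor $\gamma\in[0,1)$. For a policy $\pi:\mathcal S\to\Delta(\mathcal A)$ let $$V^\pi(s)=\mathbb E\Big[\sum_{t\ge 0}\gamma^t r(s_t,a_t)\,\Big|\, s_0=s\Big],\qquad a_t\sim\pi(\cdot\mid s_t),\ s_{t+1}\sim P(\cdot\mid s_t,a_t),$$ and $V^\pi(\mu)=\sum_s\mu(s)V^\pi(s)$ for $\mu\in\Delta(\mathcal S)$. Let $V^*(s)=\max_\pi V^\pi(s)$, $V^*(\mu)=\max_\pi V^\pi(\mu)$ and $Q^*(s,a)=r(s,a)+\gamma\sum_{s'}P(s'\mid s,a)V^*(s')$. Fix a deterministic optimal policy (one that attains $V^*(s)$ from every state $s$), let $a^*(s)$ be the action that it selects in state $s$, and let $$\Delta^*=\min_{s\in\mathcal S,\ a\ne a^*(s)}\big\{Q^*(s,a^*(s))-Q^*(s,a)\big\}$$ be the optimal value gap. For $\theta\in\mathbb R^{\mathcal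 S\times\mathcal A}$ let $\pi_\theta(a\mid s)=e^{\theta(s,a)}/\sum_{a'}e^{\theta(s,a')}$. **Theorem (lower bound).** Let $\mu\in\Delta(\mathcal S)$ be any initial state distribution, let $\theta_1\in\mathbb R^{\mathcal S\times\mathcal A}$ be arbitrary, let $\eta_t\in(0,1]$ for all $t\ge 1$, and let $$\theta_{t+1}=\theta_t+\eta_t\,\frac{\partial V^{\pi_\theta}(\mu)}{\partial\theta}\Big|_{\theta=\theta_t},\qquad t\ge 1.$$ Then there is $T\ge 1$ such that for all $t\ge T$, $$V^*(\mu)-V^{\pi_{\theta_t}}(\mu)\ \ge\ \frac{(1-\gamma)^5(\Delta^*)^2}{12\,t}.$$ (If some state has more than one optimal action, then $\Delta^*=0$ and the bound is trivial.) -/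

import Mathlib

open scoped BigOperators

noncomputable section

/-- A finite Markov decision process: transition function `P`, reward `r`, discount `γ ∈ [0, 1)`.
`stdSimplex ℝ X` is the set of probability distributions on the finite set `X`. -/
structure FiniteMDP (S A : Type*) [Fintype S] [Fintype A] where
  P : S → A → stdSimplex ℝ S
  r : S → A → ℝ
  γ : ℝ
  γ_nonneg : 0 ≤ γ
  γ_lt_one : γ < 1

/-- A (stationary, randomized) policy: `(π s).1 a` is the probability of action `a` in state `s`. -/
abbrev Policy (S A : Type*) [Fintype A] : Type _ := S → stdSimplex ℝ A

open Classical in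
/-- The deterministic policy that selects `f s` in state `s`. -/
def detPolicy {S A : Type*} [Fintype A] (f : S → A) : Policy S A :=
  fun s => ⟨Pi.single (f s) 1, single_mem_stdSimplex ℝ (f s)⟩

/-- The softmax policy `π_θ(a | s) = exp θ(s, a) / ∑ a', exp θ(s, a')`. -/
def softmaxPolicy {S A : Type*} [Fintype S] [Fintype A] [Nonempty A]
    (θ : EuclideanSpace ℝ (S × A)) : Policy S A := fun s =>
  ⟨fun a => Real.exp (θ (s, a)) / ∑ a', Real.exp (θ (s, a')), by
    have hpos : 0 < ∑ a', Real.exp (θ (s, a')) :=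
      Finset.sum_pos (fun a' _ => Real.exp_pos _) Finset.univ_nonempty
    refine ⟨fun a => div_nonneg (Real.exp_pos _).le hpos.le, ?_⟩
    rw [← Finset.sum_div]
    exact div_self hpos.ne'⟩

namespace FiniteMDP

variable {S A : Type*} [Fintype S] [Fintype A]

open Classical in
/-- `M.stateProb π s₀ t s` is the probability that `s_t = s` when `s_0 = s₀`,
`a_i ∼ π(· | s_i)` and `s_{i+1} ∼ P(· | s_i, a_i)`. -/
def stateProb (M : FiniteMDP S A) (π : Policy S A) (s₀ : S) : ℕ → S → ℝ
  | 0 => Pi.single s₀ 1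
  | t + 1 => fun s' =>
      ∑ s, ∑ a, M.stateProb π s₀ t s * (π s).1 a * (M.P s a).1 s'

/-- The value `V^π(s₀)`: the expected discounted return `∑ t, γ^t * E[r(s_t, a_t)]` from `s₀`.
The rewards of a finite MDP are bounded and `γ < 1`, so the series converges absolutely and the
expectation may be taken term by term. -/
def value (M : FiniteMDP S A) (π : Policy S A) (s₀ : S) : ℝ :=
  ∑' t : ℕ, M.γ ^ t * ∑ s, ∑ a, M.stateProb π s₀ t s * (π s).1 a * M.r s a

/-- `V^π(ρ) = E_{s ∼ ρ} V^π(s)` for an initial state distribution `ρ`. -/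
def valueFrom (M : FiniteMDP S A) (π : Policy S A) (ρ : stdSimplex ℝ S) : ℝ :=
  ∑ s, ρ.1 s * M.value π s

/-- `V*(s) = max_π V^π(s)`. -/
def optValue (M : FiniteMDP S A) (s : S) : ℝ := ⨆ π : Policy S A, M.value π s

/-- `V*(ρ) = max_π V^π(ρ)`. -/
def optValueFrom (M : FiniteMDP S A) (ρ : stdSimplex ℝ S) : ℝ :=
  ⨆ π : Policy S A, M.valueFrom π ρ

/-- `Q*(s, a) = r(s, a) + γ ∑ s', P(s' | s, a) V*(s')`. -/
def optQ (M : FiniteMDP S A) (s : S) (a : A) : ℝ :=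
  M.r s a + M.γ * ∑ s', (M.P s a).1 s' * M.optValue s'

/-- `π` is an optimal policy: from every state its value is at least that of any other policy. -/
def IsOptimal (M : FiniteMDP S A) (π : Policy S A) : Prop :=
  ∀ (π' : Policy S A) (s : S), M.value π' s ≤ M.value π s

/-- The optimal value gap `Δ* = min {Q*(s, a*(s)) - Q*(s, a) | s ∈ S, a ≠ a*(s)}`. The index set is
finite, and nonempty when there are a state and two actions, so the infimum is then a minimum. -/
def optGap (M : FiniteMDP S A) (astar : S → A) : ℝ :=
  ⨅ p : {p : S × A // p.2 ≠ astar p.1},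
    (M.optQ p.1.1 (astar p.1.1) - M.optQ p.1.1 p.1.2)

/-- The objective `θ ↦ V^{π_θ}(μ)` of softmax policy gradient. -/
def softmaxObjective [Nonempty A] (M : FiniteMDP S A) (μ : stdSimplex ℝ S)
    (θ : EuclideanSpace ℝ (S × A)) : ℝ :=
  M.valueFrom (softmaxPolicy θ) μ

/-- `θ_1, θ_2, …` is generated by the softmax policy gradient method with initial distribution `μ`
and step sizes `η_1, η_2, …`: the update is `θ_{t+1} = θ_t + η_t · ∂V^{π_{θ_t}}(μ)/∂θ_t`, and `θ_1`
is arbitrary. (The entry `θ 0` plays no role.) -/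
def IsPolicyGradientRun [Nonempty A] (M : FiniteMDP S A) (μ : stdSimplex ℝ S)
    (η : ℕ → ℝ) (θ : ℕ → EuclideanSpace ℝ (S × A)) : Prop :=
  ∀ t : ℕ, 1 ≤ t → θ (t + 1) = θ t + η t • gradient (M.softmaxObjective μ) (θ t)

end FiniteMDP

end

/-! ### Occupancies, values and performance difference identities -/

noncomputable section

namespace FiniteMDP

/-! Write `H = 1 / (1 - γ)`, `d_t = V*(μ) - V^{π_t}(μ)`, `D` for the unnormalised occupancy of `π_t`
from `μ`, and `y(s) = 1 - π_t(a*(s) | s)`. The rate comes from a recursion `d_{t+1} ≥ d_t - c d_t²`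
with `c = 9 H⁵ / Δ*²`, valid for small `d_t`: under it `1 / d_t` grows at most linearly.

The recursion is quadratic for the following reason. The performance difference identity gives `Δ* ∑
D y ≤ d_t` (`optGap_mul_sum_le`). The gradient entry at `(s, a)` is `D(s) π(a | s) A(s, a)`; since
advantages have `π`-mean zero, it is at most `H D(s) y(s)` in absolute value, so a step moves the
logits by `O(d_t)`. The gain is `∑ D'(s) ∑ π'(a | s) A(s, a)`, with `π'` the new policy and `D'` its
occupancy. The inner sum vanishes at `π' = π`, hence is itself of the order of the step, namely `O(D
y²)`. Bounding `D'` by `H` would leave only a linear bound, because it is `D y` and not `y` that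
`d_t` controls; the comparison `D' ≤ D + O(d_t)` restores the square
(`valueFrom_gradient_step_sub_le`).

Nothing is assumed about convergence, so large `d_t` must be handled too. One step multiplies each
action probability by at least a fixed `κ > 0`, so the suboptimality collected in the first `N`
moves shrinks at most by the factor `κ ^ N`, and `d_{t+1}` stays above some `ε' > 0`
(`pow_mul_le_value_sub`). A large `d_t` therefore merely resets the bound on `1 / d`. The scalar
lemma `eventually_inv_mul_le_of_quadratic_decrease` combines both regimes. -/

theorem policy_nonneg {S A : Type*} [Fintype A] (π : Policy S A) (s : S) (a : A) : 0 ≤ (π s).1 a :=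
  (π s).2.1 a

theorem policy_sum {S A : Type*} [Fintype A] (π : Policy S A) (s : S) : ∑ a, (π s).1 a = 1 :=
  (π s).2.2

variable {S A : Type*} [Fintype S] [Fintype A]

/-- The probability to move from `s` to `s'` in one step under `π`. -/
def trans (M : FiniteMDP S A) (π : Policy S A) (s s' : S) : ℝ :=
  ∑ a, (π s).1 a * (M.P s a).1 s'

/-- The discounted expected number of visits to `s` from `s₀` under `π`. -/
def occ (M : FiniteMDP S A) (π : Policy S A) (s₀ s : S) : ℝ :=
  ∑' t : ℕ, M.γ ^ t * M.stateProb π s₀ t s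

/-- The expectation of `v` after taking action `a` in state `s`. -/
def next (M : FiniteMDP S A) (s : S) (a : A) (v : S → ℝ) : ℝ :=
  ∑ s', (M.P s a).1 s' * v s'

/-- The action value function of `π`. -/
def qValue (M : FiniteMDP S A) (π : Policy S A) (s : S) (a : A) : ℝ :=
  M.r s a + M.γ * M.next s a (M.value π)

/-- The effective horizon `1 / (1 - γ)`. -/
def horizon (M : FiniteMDP S A) : ℝ := (1 - M.γ)⁻¹

theorem P_nonneg (M : FiniteMDP S A) (s : S) (a : A) (s' : S) : 0 ≤ (M.P s a).1 s' :=
  (M.P s a).2.1 s'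

theorem P_sum (M : FiniteMDP S A) (s : S) (a : A) : ∑ s', (M.P s a).1 s' = 1 := (M.P s a).2.2

theorem one_le_horizon (M : FiniteMDP S A) : 1 ≤ M.horizon := by
  have h0 := M.γ_nonneg
  have h1 := M.γ_lt_one
  exact (one_le_inv₀ (by linarith)).2 (by linarith)

theorem horizon_pos (M : FiniteMDP S A) : 0 < M.horizon :=
  lt_of_lt_of_le one_pos M.one_le_horizon

theorem horizon_eq (M : FiniteMDP S A) : M.horizon = 1 + M.γ * M.horizon := by
  have h1 := M.γ_lt_one
  have : (1 - M.γ) * M.horizon = 1 := mul_inv_cancel₀ (by linarith)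
  linarith

theorem next_mono (M : FiniteMDP S A) (s : S) (a : A) {v w : S → ℝ} (h : ∀ s, v s ≤ w s) :
    M.next s a v ≤ M.next s a w :=
  Finset.sum_le_sum fun s' _ => mul_le_mul_of_nonneg_left (h s') (M.P_nonneg s a s')

theorem next_const (M : FiniteMDP S A) (s : S) (a : A) (c : ℝ) :
    M.next s a (fun _ => c) = c := by
  simp [next, ← Finset.sum_mul, M.P_sum s a]

theorem next_sub (M : FiniteMDP S A) (s : S) (a : A) (v w : S → ℝ) :
    M.next s a (fun s => v s - w s) = M.next s a v - M.next s a w := by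
  simp [next, mul_sub]

theorem next_smul (M : FiniteMDP S A) (s : S) (a : A) (c : ℝ) (v : S → ℝ) :
    M.next s a (fun s => c * v s) = c * M.next s a v := by
  simp only [next, Finset.mul_sum]
  exact Finset.sum_congr rfl fun _ _ => by ring

theorem sum_trans_mul (M : FiniteMDP S A) (π : Policy S A) (s : S) (v : S → ℝ) :
    ∑ s', M.trans π s s' * v s' = ∑ a, (π s).1 a * M.next s a v := by
  simp only [trans, next, Finset.sum_mul, Finset.mul_sum]
  rw [Finset.sum_comm]
  exact Finset.sum_congr rfl fun _ _ => Finset.sum_congr rfl fun _ _ => by ring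

theorem stateProb_succ (M : FiniteMDP S A) (π : Policy S A) (s₀ : S) (t : ℕ) (s' : S) :
    M.stateProb π s₀ (t + 1) s' = ∑ s, M.stateProb π s₀ t s * M.trans π s s' := by
  simp only [stateProb, trans, Finset.mul_sum, mul_assoc]

theorem trans_nonneg (M : FiniteMDP S A) (π : Policy S A) (s s' : S) : 0 ≤ M.trans π s s' :=
  Finset.sum_nonneg fun a _ => mul_nonneg (policy_nonneg π s a) (M.P_nonneg s a s')

theorem trans_sum (M : FiniteMDP S A) (π : Policy S A) (s : S) : ∑ s', M.trans π s s' = 1 := by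
  have := M.sum_trans_mul π s (fun _ => 1)
  simpa [M.next_const, policy_sum π s] using this

theorem stateProb_nonneg (M : FiniteMDP S A) (π : Policy S A) (s₀ : S) (t : ℕ) (s : S) :
    0 ≤ M.stateProb π s₀ t s := by
  classical
  induction t generalizing s with
  | zero =>
    simp only [stateProb, Pi.single_apply]
    split_ifs <;> norm_num
  | succ t ih =>
    rw [stateProb_succ]
    exact Finset.sum_nonneg fun s' _ => mul_nonneg (ih s') (M.trans_nonneg π s' s)

theorem stateProb_sum (M : FiniteMDP S A) (π : Policy S A) (s₀ : S) (t : ℕ) :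
    ∑ s, M.stateProb π s₀ t s = 1 := by
  classical
  induction t with
  | zero => simp [stateProb]
  | succ t ih =>
    simp only [stateProb_succ]
    rw [Finset.sum_comm]
    simp only [← Finset.mul_sum, M.trans_sum, mul_one, ih]

theorem stateProb_le_one (M : FiniteMDP S A) (π : Policy S A) (s₀ : S) (t : ℕ) (s : S) :
    M.stateProb π s₀ t s ≤ 1 := by
  rw [← M.stateProb_sum π s₀ t]
  exact Finset.single_le_sum (fun s _ => M.stateProb_nonneg π s₀ t s) (Finset.mem_univ s)

theorem summable_occ (M : FiniteMDP S A) (π : Policy S A) (s₀ s : S) :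
    Summable fun t : ℕ => M.γ ^ t * M.stateProb π s₀ t s := by
  refine Summable.of_nonneg_of_le
    (fun t => mul_nonneg (pow_nonneg M.γ_nonneg t) (M.stateProb_nonneg π s₀ t s))
    (fun t => mul_le_of_le_one_right (pow_nonneg M.γ_nonneg t) (M.stateProb_le_one π s₀ t s))
    (summable_geometric_of_lt_one M.γ_nonneg M.γ_lt_one)

theorem occ_nonneg (M : FiniteMDP S A) (π : Policy S A) (s₀ s : S) : 0 ≤ M.occ π s₀ s :=
  tsum_nonneg fun t => mul_nonneg (pow_nonneg M.γ_nonneg t) (M.stateProb_nonneg π s₀ t s)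

theorem sum_occ_mul (M : FiniteMDP S A) (π : Policy S A) (s₀ : S) (g : S → ℝ) :
    ∑ s, M.occ π s₀ s * g s = ∑' t : ℕ, M.γ ^ t * ∑ s, M.stateProb π s₀ t s * g s := by
  simp only [occ, ← tsum_mul_right]
  rw [← Summable.tsum_finsetSum fun s _ => (M.summable_occ π s₀ s).mul_right _]
  simp only [Finset.mul_sum, mul_assoc]

theorem occ_sum (M : FiniteMDP S A) (π : Policy S A) (s₀ : S) :
    ∑ s, M.occ π s₀ s = M.horizon := by
  have := M.sum_occ_mul π s₀ (fun _ => 1)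
  simpa [horizon, M.stateProb_sum, tsum_geometric_of_lt_one M.γ_nonneg M.γ_lt_one] using this

open Classical in
theorem occ_forward (M : FiniteMDP S A) (π : Policy S A) (s₀ s : S) :
    M.occ π s₀ s = (if s₀ = s then 1 else 0) + M.γ * ∑ s', M.occ π s₀ s' * M.trans π s' s := by
  rw [sum_occ_mul, occ, (M.summable_occ π s₀ s).tsum_eq_zero_add, ← tsum_mul_left]
  congr 1
  · simp [stateProb, Pi.single_apply, eq_comm]
  · refine tsum_congr fun t => ?_
    rw [stateProb_succ]
    ring

theorem one_le_occ_self (M : FiniteMDP S A) (π : Policy S A) (s : S) : 1 ≤ M.occ π s s := by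
  classical
  rw [occ_forward, if_pos rfl]
  have : 0 ≤ M.γ * ∑ s', M.occ π s s' * M.trans π s' s :=
    mul_nonneg M.γ_nonneg (Finset.sum_nonneg fun s' _ =>
      mul_nonneg (M.occ_nonneg π s s') (M.trans_nonneg π s' s))
  linarith

/-- The occupancy matrix is a left inverse of `1 - γ P_π`. -/
theorem sum_occ_mul_sub (M : FiniteMDP S A) (π : Policy S A) (s₀ : S) (v : S → ℝ) :
    ∑ s, M.occ π s₀ s * (v s - ∑ a, (π s).1 a * (M.γ * M.next s a v)) = v s₀ := by
  classical
  have h : ∑ s, M.occ π s₀ s * v s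
      = v s₀ + ∑ s, M.occ π s₀ s * ∑ a, (π s).1 a * (M.γ * M.next s a v) := by
    have h1 : ∀ s, ∑ a, (π s).1 a * (M.γ * M.next s a v)
        = M.γ * ∑ s', M.trans π s s' * v s' := fun s => by
      rw [sum_trans_mul, Finset.mul_sum]
      exact Finset.sum_congr rfl fun _ _ => by ring
    simp only [h1]
    conv_lhs => enter [2, s]; rw [occ_forward]
    simp only [add_mul, Finset.sum_add_distrib, ite_mul, one_mul, zero_mul, Finset.sum_ite_eq,
      Finset.mem_univ, if_true]
    congr 1
    simp only [Finset.mul_sum, Finset.sum_mul]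
    rw [Finset.sum_comm]
    exact Finset.sum_congr rfl fun _ _ => Finset.sum_congr rfl fun _ _ => by ring
  simp only [mul_sub, Finset.sum_sub_distrib, h]
  ring

-- `stateProb` appends moves at the end, so it yields the forward equation, a left inverse of `1 - γ
-- P_π`. For square matrices this is also a right inverse, which is the equation obtained by
-- conditioning on the first move.
open Classical in
theorem occ_backward (M : FiniteMDP S A) (π : Policy S A) (s₀ s : S) :
    M.occ π s₀ s = (if s₀ = s then 1 else 0)
      + ∑ a, (π s₀).1 a * (M.γ * M.next s₀ a (fun s' => M.occ π s' s)) := by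
  let D : Matrix S S ℝ := Matrix.of (M.occ π)
  let T : Matrix S S ℝ := Matrix.of (M.trans π)
  have h : D * (1 - M.γ • T) = 1 := by
    rw [mul_sub, mul_one, Matrix.mul_smul, sub_eq_iff_eq_add]
    ext i j
    simpa [Matrix.mul_apply, Matrix.one_apply, D, T] using M.occ_forward π i j
  have h2 : (1 - M.γ • T) * D = 1 := mul_eq_one_comm.1 h
  rw [sub_mul, one_mul, Matrix.smul_mul, sub_eq_iff_eq_add] at h2
  have h3 := congrFun (congrFun h2 s₀) s
  simp only [Matrix.add_apply, Matrix.one_apply, Matrix.smul_apply, Matrix.mul_apply, D, T,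
    Matrix.of_apply, smul_eq_mul] at h3
  rw [h3, M.sum_trans_mul π s₀ (fun s' => M.occ π s' s), Finset.mul_sum]
  congr 1
  exact Finset.sum_congr rfl fun _ _ => by ring

theorem value_eq_sum_occ (M : FiniteMDP S A) (π : Policy S A) (s₀ : S) :
    M.value π s₀ = ∑ s, M.occ π s₀ s * ∑ a, (π s).1 a * M.r s a := by
  rw [sum_occ_mul]
  simp only [value, Finset.mul_sum, mul_assoc]

theorem value_bellman (M : FiniteMDP S A) (π : Policy S A) (s : S) :
    M.value π s = ∑ a, (π s).1 a * M.qValue π s a := by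
  classical
  have h1 : ∀ s, M.value π s = ∑ s', M.occ π s s' * ∑ a, (π s').1 a * M.r s' a :=
    M.value_eq_sum_occ π
  have h2 : ∀ a, M.next s a (M.value π)
      = ∑ s', M.next s a (fun z => M.occ π z s') * ∑ a, (π s').1 a * M.r s' a := by
    intro a
    simp only [next, h1, Finset.sum_mul]
    simp_rw [Finset.mul_sum (s := Finset.univ) (f := fun i => M.occ π _ i * _)]
    rw [Finset.sum_comm]
    simp only [mul_assoc]
  simp only [qValue, mul_add, Finset.sum_add_distrib, h2]
  rw [h1]
  conv_lhs => enter [2, s']; rw [occ_backward]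
  simp only [add_mul, Finset.sum_add_distrib, ite_mul, one_mul, zero_mul, Finset.sum_ite_eq,
      Finset.mem_univ, if_true]
  congr 1
  simp only [Finset.sum_mul]
  rw [Finset.sum_comm]
  refine Finset.sum_congr rfl fun a _ => ?_
  rw [Finset.mul_sum, Finset.mul_sum]
  exact Finset.sum_congr rfl fun _ _ => by ring

/-- Performance difference, with the occupancy of the first policy. -/
theorem value_sub_value (M : FiniteMDP S A) (π' π : Policy S A) (s₀ : S) :
    M.value π' s₀ - M.value π s₀
      = ∑ s, M.occ π' s₀ s * ∑ a, (π' s).1 a * (M.qValue π s a - M.value π s) := by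
  rw [← M.sum_occ_mul_sub π' s₀ (M.value π), M.value_eq_sum_occ π', ← Finset.sum_sub_distrib]
  refine Finset.sum_congr rfl fun s _ => ?_
  rw [← mul_sub]
  simp only [qValue, mul_sub, mul_add, Finset.sum_sub_distrib, Finset.sum_add_distrib,
    ← Finset.sum_mul, policy_sum, one_mul]
  ring

/-- Performance difference, with the occupancy of the second policy. -/
theorem value_sub_value_of_occ_right (M : FiniteMDP S A) (π' π : Policy S A) (s₀ : S) :
    M.value π' s₀ - M.value π s₀
      = ∑ s, M.occ π s₀ s * ∑ a, ((π' s).1 a - (π s).1 a) * M.qValue π' s a := by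
  have h := M.value_sub_value π π' s₀
  rw [← neg_sub, h, ← Finset.sum_neg_distrib]
  refine Finset.sum_congr rfl fun s _ => ?_
  rw [← mul_neg]
  congr 1
  simp only [mul_sub, sub_mul, Finset.sum_sub_distrib, ← M.value_bellman, ← Finset.sum_mul,
    policy_sum, one_mul]
  ring

/-- The resolvent identity `D' - D = γ D (P' - P) D'`. -/
theorem occ_sub_occ (M : FiniteMDP S A) (π' π : Policy S A) (s₀ s : S) :
    M.occ π' s₀ s - M.occ π s₀ s = ∑ z, M.occ π s₀ z * ∑ a, ((π' z).1 a - (π z).1 a) *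
      (M.γ * M.next z a (fun s' => M.occ π' s' s)) := by
  classical
  have h1 := M.sum_occ_mul_sub π s₀ (fun s' => M.occ π' s' s)
  have h2 : ∑ z, M.occ π s₀ z * (M.occ π' z s
      - ∑ a, (π' z).1 a * (M.γ * M.next z a (fun s' => M.occ π' s' s))) = M.occ π s₀ s := by
    have h3 : ∀ z, M.occ π' z s - ∑ a, (π' z).1 a * (M.γ * M.next z a (fun s' => M.occ π' s' s))
        = if z = s then 1 else 0 := fun z => by
      rw [sub_eq_iff_eq_add]
      exact M.occ_backward π' z s
    simp [h3]
  rw [← h2, ← h1, ← Finset.sum_sub_distrib]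
  refine Finset.sum_congr rfl fun z _ => ?_
  rw [← mul_sub]
  simp only [sub_mul, Finset.sum_sub_distrib]
  ring

theorem valueFrom_sub (M : FiniteMDP S A) (π π' : Policy S A) (μ : stdSimplex ℝ S) :
    M.valueFrom π μ - M.valueFrom π' μ = ∑ s, μ.1 s * (M.value π s - M.value π' s) := by
  simp [valueFrom, mul_sub]

/-- The occupancy from an initial distribution. -/
def occFrom (M : FiniteMDP S A) (π : Policy S A) (μ : stdSimplex ℝ S) (s : S) : ℝ :=
  ∑ s₀, μ.1 s₀ * M.occ π s₀ s

theorem sum_mul_sum_occ (M : FiniteMDP S A) (π : Policy S A) (μ : stdSimplex ℝ S) (g : S → ℝ) :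
    ∑ s₀, μ.1 s₀ * ∑ s, M.occ π s₀ s * g s = ∑ s, M.occFrom π μ s * g s := by
  simp only [occFrom, Finset.sum_mul, Finset.mul_sum]
  rw [Finset.sum_comm]
  simp only [mul_assoc]

theorem occFrom_nonneg (M : FiniteMDP S A) (π : Policy S A) (μ : stdSimplex ℝ S) (s : S) :
    0 ≤ M.occFrom π μ s :=
  Finset.sum_nonneg fun s₀ _ => mul_nonneg (μ.2.1 s₀) (M.occ_nonneg π s₀ s)

theorem occFrom_sum (M : FiniteMDP S A) (π : Policy S A) (μ : stdSimplex ℝ S) :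
    ∑ s, M.occFrom π μ s = M.horizon := by
  have := M.sum_mul_sum_occ π μ (fun _ => 1)
  simp only [mul_one, occ_sum, ← Finset.sum_mul] at this
  rw [← this, μ.2.2, one_mul]

theorem occFrom_le (M : FiniteMDP S A) (π : Policy S A) (μ : stdSimplex ℝ S) (s : S) :
    M.occFrom π μ s ≤ M.horizon := by
  rw [← M.occFrom_sum π μ]
  exact Finset.single_le_sum (fun s _ => M.occFrom_nonneg π μ s) (Finset.mem_univ s)

theorem occ_le (M : FiniteMDP S A) (π : Policy S A) (s₀ s : S) : M.occ π s₀ s ≤ M.horizon := by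
  rw [← M.occ_sum π s₀]
  exact Finset.single_le_sum (fun s _ => M.occ_nonneg π s₀ s) (Finset.mem_univ s)

theorem valueFrom_sub_valueFrom (M : FiniteMDP S A) (π' π : Policy S A) (μ : stdSimplex ℝ S) :
    M.valueFrom π' μ - M.valueFrom π μ
      = ∑ s, M.occFrom π' μ s * ∑ a, (π' s).1 a * (M.qValue π s a - M.value π s) := by
  simp only [valueFrom_sub, value_sub_value, sum_mul_sum_occ]

theorem valueFrom_sub_valueFrom_of_occ_right (M : FiniteMDP S A) (π' π : Policy S A)
    (μ : stdSimplex ℝ S) :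
    M.valueFrom π' μ - M.valueFrom π μ
      = ∑ s, M.occFrom π μ s * ∑ a, ((π' s).1 a - (π s).1 a) * M.qValue π' s a := by
  simp only [valueFrom_sub, value_sub_value_of_occ_right, sum_mul_sum_occ]

theorem occFrom_sub_occFrom (M : FiniteMDP S A) (π' π : Policy S A) (μ : stdSimplex ℝ S) (s : S) :
    M.occFrom π' μ s - M.occFrom π μ s
      = ∑ z, M.occFrom π μ z * ∑ a, ((π' z).1 a - (π z).1 a) *
          (M.γ * M.next z a (fun s' => M.occ π' s' s)) := by
  rw [← sum_mul_sum_occ]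
  simp only [← occ_sub_occ, mul_sub, Finset.sum_sub_distrib, occFrom]

theorem value_mem (M : FiniteMDP S A) (hr : ∀ s a, M.r s a ∈ Set.Icc (0 : ℝ) 1)
    (π : Policy S A) (s : S) : M.value π s ∈ Set.Icc 0 M.horizon := by
  rw [value_eq_sum_occ]
  have h0 : ∀ z, 0 ≤ ∑ a, (π z).1 a * M.r z a := fun z =>
    Finset.sum_nonneg fun a _ => mul_nonneg (policy_nonneg π z a) (hr z a).1
  have h1 : ∀ z, ∑ a, (π z).1 a * M.r z a ≤ 1 := fun z => by
    rw [← policy_sum π z]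
    exact Finset.sum_le_sum fun a _ => mul_le_of_le_one_right (policy_nonneg π z a) (hr z a).2
  refine ⟨Finset.sum_nonneg fun z _ => mul_nonneg (M.occ_nonneg π s z) (h0 z), ?_⟩
  rw [← M.occ_sum π s]
  exact Finset.sum_le_sum fun z _ => mul_le_of_le_one_right (M.occ_nonneg π s z) (h1 z)

theorem qValue_mem (M : FiniteMDP S A) (hr : ∀ s a, M.r s a ∈ Set.Icc (0 : ℝ) 1)
    (π : Policy S A) (s : S) (a : A) : M.qValue π s a ∈ Set.Icc 0 M.horizon := by
  have h0 : 0 ≤ M.next s a (M.value π) := by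
    rw [← M.next_const s a 0]
    exact M.next_mono s a fun s => (M.value_mem hr π s).1
  have h1 : M.next s a (M.value π) ≤ M.horizon := by
    rw [← M.next_const s a M.horizon]
    exact M.next_mono s a fun s => (M.value_mem hr π s).2
  refine ⟨add_nonneg (hr s a).1 (mul_nonneg M.γ_nonneg h0), ?_⟩
  rw [horizon_eq]
  exact add_le_add (hr s a).2 (mul_le_mul_of_nonneg_left h1 M.γ_nonneg)

/-- The advantage function of `π`. -/
def adv (M : FiniteMDP S A) (π : Policy S A) (s : S) (a : A) : ℝ :=
  M.qValue π s a - M.value π s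

theorem abs_adv_le (M : FiniteMDP S A) (hr : ∀ s a, M.r s a ∈ Set.Icc (0 : ℝ) 1)
    (π : Policy S A) (s : S) (a : A) : |M.adv π s a| ≤ M.horizon := by
  have h1 := M.value_mem hr π s
  have h2 := M.qValue_mem hr π s a
  rw [adv, abs_le]
  constructor <;> linarith [h1.1, h1.2, h2.1, h2.2]

theorem sum_policy_mul_adv (M : FiniteMDP S A) (π : Policy S A) (s : S) :
    ∑ a, (π s).1 a * M.adv π s a = 0 := by
  simp only [adv, mul_sub, Finset.sum_sub_distrib, ← M.value_bellman, ← Finset.sum_mul,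
    policy_sum, one_mul, sub_self]

end FiniteMDP

end

/-! ### Differentiability and the policy gradient -/

noncomputable section

/-- If `f y - f x = ∑ i, (u i y - u i x) * w i y` with `u i` differentiable and `w i` continuous at
`x`, then `f` is differentiable at `x`. -/
theorem hasFDerivAt_of_sub_eq_sum {E ι : Type*} [NormedAddCommGroup E] [NormedSpace ℝ E]
    [Fintype ι] {f : E → ℝ} {u w : ι → E → ℝ} {u' : ι → E →L[ℝ] ℝ} {x : E}
    (hu : ∀ i, HasFDerivAt (u i) (u' i) x) (hw : ∀ i, ContinuousAt (w i) x)
    (hf : ∀ y, f y - f x = ∑ i, (u i y - u i x) * w i y) :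
    HasFDerivAt f (∑ i, w i x • u' i) x := by
  have h1 : ∀ i, HasFDerivAt (fun y => (u i y - u i x) * w i y) (w i x • u' i) x := by
    intro i
    -- A factor `O(‖y - x‖)` times a factor `o(1)`: replacing `w i y` by `w i x` costs nothing to
    -- first order.
    have h2 : HasFDerivAt (fun y => (u i y - u i x) * (w i y - w i x)) (0 : E →L[ℝ] ℝ) x := by
      rw [hasFDerivAt_iff_isLittleO]
      have hO := (hu i).isBigO_sub
      have ho : (fun y => w i y - w i x) =o[nhds x] fun _ => (1 : ℝ) := by
        rw [Asymptotics.isLittleO_one_iff]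
        simpa using Filter.Tendsto.sub_const (hw i) (w i x)
      have := hO.norm_right.mul_isLittleO ho
      simp only [sub_self, zero_mul, sub_zero, zero_apply]
      refine Asymptotics.IsLittleO.trans_isBigO this ?_
      simp only [mul_one]
      exact (Asymptotics.isBigO_refl _ _).norm_left
    have h3 := h2.add (((hu i).sub_const (u i x)).mul_const (w i x))
    rw [zero_add] at h3
    refine h3.congr_of_eventuallyEq (Filter.Eventually.of_forall fun y => ?_)
    simp only [Pi.add_apply]
    ring
  have h4 := (HasFDerivAt.fun_sum fun i (_ : i ∈ Finset.univ) => h1 i).add_const (f x)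
  refine h4.congr_of_eventuallyEq (Filter.Eventually.of_forall fun y => ?_)
  simp only [← hf]
  ring

section Softmax

variable {S A : Type*} [Fintype S] [Fintype A] [Nonempty A]

theorem softmaxPolicy_apply (θ : EuclideanSpace ℝ (S × A)) (s : S) (a : A) :
    (softmaxPolicy θ s).1 a = Real.exp (θ (s, a)) / ∑ b, Real.exp (θ (s, b)) := rfl

theorem sum_exp_pos (θ : EuclideanSpace ℝ (S × A)) (s : S) :
    0 < ∑ b, Real.exp (θ (s, b)) :=
  Finset.sum_pos (fun _ _ => Real.exp_pos _) Finset.univ_nonempty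

theorem softmaxPolicy_pos (θ : EuclideanSpace ℝ (S × A)) (s : S) (a : A) :
    0 < (softmaxPolicy θ s).1 a :=
  div_pos (Real.exp_pos _) (sum_exp_pos θ s)

theorem softmaxPolicy_add (θ x : EuclideanSpace ℝ (S × A)) (s : S) (a : A) :
    (softmaxPolicy (θ + x) s).1 a = (softmaxPolicy θ s).1 a * Real.exp (x (s, a)) /
      ∑ b, (softmaxPolicy θ s).1 b * Real.exp (x (s, b)) := by
  have h := sum_exp_pos θ s
  simp only [softmaxPolicy_apply, PiLp.add_apply, Real.exp_add, div_mul_eq_mul_div,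
    ← Finset.sum_div]
  rw [div_div_div_cancel_right₀ h.ne']

theorem hasFDerivAt_softmaxPolicy (θ : EuclideanSpace ℝ (S × A)) (s : S) (a : A) :
    HasFDerivAt (fun θ : EuclideanSpace ℝ (S × A) => (softmaxPolicy θ s).1 a)
      ((softmaxPolicy θ s).1 a • (EuclideanSpace.proj (s, a)
        - ∑ b, (softmaxPolicy θ s).1 b • EuclideanSpace.proj (𝕜 := ℝ) (s, b))) θ := by
  have h := sum_exp_pos θ s
  have hp : ∀ b, HasFDerivAt (fun θ : EuclideanSpace ℝ (S × A) => Real.exp (θ (s, b)))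
      (Real.exp (θ (s, b)) • EuclideanSpace.proj (𝕜 := ℝ) (s, b)) θ := fun b =>
    (EuclideanSpace.proj (𝕜 := ℝ) (ι := S × A) (s, b)).hasFDerivAt.exp
  have hs := HasFDerivAt.fun_sum fun b (_ : b ∈ Finset.univ) => hp b
  have hd := (hp a).mul ((hasDerivAt_inv h.ne').comp_hasFDerivAt θ hs)
  refine hd.congr_fderiv ?_
  ext v
  rw [add_apply]
  simp only [Function.comp_apply, softmaxPolicy_apply, smul_apply, sub_apply,
    sum_apply, smul_eq_mul, PiLp.proj_apply]
  have h2 : ∑ b, Real.exp (θ (s, b)) / (∑ b, Real.exp (θ (s, b))) * v (s, b)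
      = (∑ b, Real.exp (θ (s, b)) * v (s, b)) / ∑ b, Real.exp (θ (s, b)) := by
    rw [Finset.sum_div]
    exact Finset.sum_congr rfl fun _ _ => by ring
  rw [h2]
  field_simp
  ring

end Softmax

namespace FiniteMDP

variable {S A : Type*} [Fintype S] [Fintype A] [Nonempty A]

/-- With the occupancy of the fixed policy as weights, the value difference is dominated by policy
differences times the horizon, so the series itself need not be shown continuous in `θ`. -/
theorem continuous_value_softmaxPolicy (M : FiniteMDP S A)
    (hr : ∀ s a, M.r s a ∈ Set.Icc (0 : ℝ) 1) (s : S) :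
    Continuous fun θ : EuclideanSpace ℝ (S × A) => M.value (softmaxPolicy θ) s := by
  rw [continuous_iff_continuousAt]
  intro θ
  have hb : ∀ θ', |M.value (softmaxPolicy θ') s - M.value (softmaxPolicy θ) s| ≤
      ∑ z, M.occ (softmaxPolicy θ) s z *
        ∑ a, |(softmaxPolicy θ' z).1 a - (softmaxPolicy θ z).1 a| * M.horizon := by
    intro θ'
    rw [value_sub_value_of_occ_right]
    refine (Finset.abs_sum_le_sum_abs _ _).trans (Finset.sum_le_sum fun z _ => ?_)
    rw [abs_mul, abs_of_nonneg (M.occ_nonneg _ s z)]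
    refine mul_le_mul_of_nonneg_left ?_ (M.occ_nonneg _ s z)
    refine (Finset.abs_sum_le_sum_abs _ _).trans (Finset.sum_le_sum fun a _ => ?_)
    rw [abs_mul]
    have hq := M.qValue_mem hr (softmaxPolicy θ') z a
    rw [abs_of_nonneg hq.1]
    exact mul_le_mul_of_nonneg_left hq.2 (abs_nonneg _)
  have hc : ContinuousAt (fun θ' : EuclideanSpace ℝ (S × A) => ∑ z, M.occ (softmaxPolicy θ) s z *
      ∑ a, |(softmaxPolicy θ' z).1 a - (softmaxPolicy θ z).1 a| * M.horizon) θ := by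
    refine tendsto_finsetSum _ fun z _ => ContinuousAt.mul continuousAt_const ?_
    refine tendsto_finsetSum _ fun a _ => ContinuousAt.mul ?_ continuousAt_const
    exact ((hasFDerivAt_softmaxPolicy θ z a).continuousAt.sub continuousAt_const).abs
  have hc' := hc.tendsto
  simp only [sub_self, abs_zero, zero_mul, Finset.sum_const_zero, mul_zero] at hc'
  refine tendsto_iff_norm_sub_tendsto_zero.2 ?_
  exact squeeze_zero (fun _ => norm_nonneg _) hb hc'

/-- The gradient of the softmax objective: the policy gradient theorem. -/
def softmaxGradient (M : FiniteMDP S A) (μ : stdSimplex ℝ S) (θ : EuclideanSpace ℝ (S × A)) :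
    EuclideanSpace ℝ (S × A) :=
  WithLp.toLp 2 fun p => M.occFrom (softmaxPolicy θ) μ p.1 *
    ((softmaxPolicy θ p.1).1 p.2 * M.adv (softmaxPolicy θ) p.1 p.2)

/-- The same identity writes the increment as policy differences times continuous action values,
which is the form that `hasFDerivAt_of_sub_eq_sum` differentiates. -/
theorem gradient_softmaxObjective (M : FiniteMDP S A)
    (hr : ∀ s a, M.r s a ∈ Set.Icc (0 : ℝ) 1) (μ : stdSimplex ℝ S)
    (θ : EuclideanSpace ℝ (S × A)) :
    gradient (M.softmaxObjective μ) θ = M.softmaxGradient μ θ := by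
  refine HasGradientAt.gradient ?_
  rw [hasGradientAt_iff_hasFDerivAt]
  have hw : ∀ p : S × A, ContinuousAt (fun θ' : EuclideanSpace ℝ (S × A) =>
      M.occFrom (softmaxPolicy θ) μ p.1 * M.qValue (softmaxPolicy θ') p.1 p.2) θ := by
    intro p
    refine (Continuous.mul continuous_const (continuous_const.add
      (continuous_const.mul ?_))).continuousAt
    exact continuous_finsetSum _ fun s _ =>
      continuous_const.mul (M.continuous_value_softmaxPolicy hr s)
  have hf := hasFDerivAt_of_sub_eq_sum (f := M.softmaxObjective μ)
    (fun p : S × A => hasFDerivAt_softmaxPolicy θ p.1 p.2) hw (fun θ' => by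
      rw [softmaxObjective, softmaxObjective, valueFrom_sub_valueFrom_of_occ_right,
        Fintype.sum_prod_type]
      refine Finset.sum_congr rfl fun s _ => ?_
      rw [Finset.mul_sum]
      exact Finset.sum_congr rfl fun _ _ => by ring)
  refine hf.congr_fderiv ?_
  ext v
  simp only [smul_apply, sub_apply,
    sum_apply, smul_eq_mul, PiLp.proj_apply,
    InnerProductSpace.toDual_apply_apply, PiLp.inner_apply, Fintype.sum_prod_type, softmaxGradient]
  refine Finset.sum_congr rfl fun s _ => ?_
  -- Used with `c = ∑ b, π(b | s) v(s, b)`: the centering in the softmax derivative turns action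
  -- values into advantages.
  have h1 : ∀ c : ℝ, ∑ a, M.occFrom (softmaxPolicy θ) μ s * M.qValue (softmaxPolicy θ) s a *
      ((softmaxPolicy θ s).1 a * (v (s, a) - c))
      = ∑ a, M.occFrom (softmaxPolicy θ) μ s * M.qValue (softmaxPolicy θ) s a *
      ((softmaxPolicy θ s).1 a * v (s, a)) -
      M.occFrom (softmaxPolicy θ) μ s * M.value (softmaxPolicy θ) s * c := by
    intro c
    rw [value_bellman]
    simp only [Finset.mul_sum, Finset.sum_mul, ← Finset.sum_sub_distrib]
    exact Finset.sum_congr rfl fun _ _ => by ring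
  rw [h1, Finset.mul_sum, ← Finset.sum_sub_distrib]
  refine Finset.sum_congr rfl fun a _ => ?_
  simp only [adv, RCLike.inner_apply, conj_trivial]
  ring

end FiniteMDP

end

/-! ### Exponential tilting of a distribution -/

noncomputable section

section Tilt

variable {A : Type*} [Fintype A] {p x : A → ℝ} {X : ℝ}

/-- Here `p` plays the action distribution at one state and `x` the increment of its logits; this
sum normalises the updated distribution. -/
theorem tilt_normalizer_mem (hp : ∀ a, 0 ≤ p a) (hs : ∑ a, p a = 1) (hx : ∀ a, |x a| ≤ X) :
    Real.exp (-X) ≤ ∑ a, p a * Real.exp (x a) ∧ ∑ a, p a * Real.exp (x a) ≤ Real.exp X := by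
  constructor
  · calc Real.exp (-X) = ∑ a, p a * Real.exp (-X) := by rw [← Finset.sum_mul, hs, one_mul]
      _ ≤ _ := Finset.sum_le_sum fun a _ => mul_le_mul_of_nonneg_left
        (Real.exp_le_exp.2 (neg_le_of_abs_le (hx a))) (hp a)
  · calc ∑ a, p a * Real.exp (x a) ≤ ∑ a, p a * Real.exp X := by
          exact Finset.sum_le_sum fun a _ => mul_le_mul_of_nonneg_left
            (Real.exp_le_exp.2 (le_of_abs_le (hx a))) (hp a)
      _ = Real.exp X := by rw [← Finset.sum_mul, hs, one_mul]

theorem inv_tilt_normalizer_le (hp : ∀ a, 0 ≤ p a) (hs : ∑ a, p a = 1) (hx : ∀ a, |x a| ≤ X) :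
    (∑ a, p a * Real.exp (x a))⁻¹ ≤ Real.exp X := by
  have h := (tilt_normalizer_mem hp hs hx).1
  rw [← neg_neg X, Real.exp_neg (-X)]
  exact inv_anti₀ (Real.exp_pos _) h

theorem exp_mul_le_tilt (hp : ∀ a, 0 ≤ p a) (hs : ∑ a, p a = 1) (hx : ∀ a, |x a| ≤ X) (a : A) :
    Real.exp (-(2 * X)) * p a ≤ p a * Real.exp (x a) / ∑ b, p b * Real.exp (x b) := by
  obtain ⟨h1, h2⟩ := tilt_normalizer_mem hp hs hx
  have h0 := (Real.exp_pos (-X)).trans_le h1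
  rw [le_div_iff₀ h0]
  have h3 : Real.exp (-(2 * X)) * Real.exp X = Real.exp (-X) := by
    rw [← Real.exp_add]
    ring_nf
  calc Real.exp (-(2 * X)) * p a * ∑ b, p b * Real.exp (x b)
      ≤ Real.exp (-(2 * X)) * p a * Real.exp X :=
        mul_le_mul_of_nonneg_left h2 (mul_nonneg (Real.exp_pos _).le (hp a))
    _ = p a * Real.exp (-X) := by rw [← h3]; ring
    _ ≤ _ := mul_le_mul_of_nonneg_left (Real.exp_le_exp.2 (neg_le_of_abs_le (hx a))) (hp a)

theorem exp_sub_exp_le {x y X : ℝ} (hx : x ≤ X) :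
    Real.exp x - Real.exp y ≤ Real.exp X * |x - y| := by
  have h1 : Real.exp x - Real.exp y = Real.exp x * (1 - Real.exp (y - x)) := by
    rw [mul_sub, mul_one, ← Real.exp_add]
    ring_nf
  have h2 := Real.add_one_le_exp (y - x)
  rw [h1]
  calc Real.exp x * (1 - Real.exp (y - x)) ≤ Real.exp x * |x - y| :=
        mul_le_mul_of_nonneg_left (by linarith [le_abs_self (x - y)]) (Real.exp_pos _).le
    _ ≤ _ := mul_le_mul_of_nonneg_right (Real.exp_le_exp.2 hx) (abs_nonneg _)

theorem abs_exp_sub_exp_le {x y X : ℝ} (hx : x ≤ X) (hy : y ≤ X) :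
    |Real.exp x - Real.exp y| ≤ Real.exp X * |x - y| := by
  rw [abs_le]
  have h1 := exp_sub_exp_le (y := y) hx
  have h2 := exp_sub_exp_le (y := x) hy
  rw [abs_sub_comm] at h2
  constructor <;> linarith

/-- With `Z` the normaliser, each difference is `p a * (exp (x a) - Z) / Z`, and `exp (x a) - Z` is
a `p`-average of differences of exponentials. The weights `p a` keep the bound free of the number of
actions. -/
theorem sum_abs_tilt_sub_le (hp : ∀ a, 0 ≤ p a) (hs : ∑ a, p a = 1) (hx : ∀ a, |x a| ≤ X) :
    ∑ a, |p a * Real.exp (x a) / (∑ b, p b * Real.exp (x b)) - p a|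
      ≤ 2 * X * Real.exp (2 * X) := by
  obtain ⟨h1, -⟩ := tilt_normalizer_mem hp hs hx
  have hi := inv_tilt_normalizer_le hp hs hx
  set Z := ∑ b, p b * Real.exp (x b) with hZ
  have h0 : 0 < Z := (Real.exp_pos (-X)).trans_le h1
  have h2 : ∀ a, |Real.exp (x a) - Z| ≤ Real.exp X * (2 * X) := by
    intro a
    have h3 : Real.exp (x a) - Z = ∑ b, p b * (Real.exp (x a) - Real.exp (x b)) := by
      simp only [mul_sub, Finset.sum_sub_distrib, ← Finset.sum_mul, hs, one_mul, hZ]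
    rw [h3]
    refine (Finset.abs_sum_le_sum_abs _ _).trans ?_
    calc ∑ b, |p b * (Real.exp (x a) - Real.exp (x b))|
        ≤ ∑ b, p b * (Real.exp X * (2 * X)) := by
          refine Finset.sum_le_sum fun b _ => ?_
          rw [abs_mul, abs_of_nonneg (hp b)]
          refine mul_le_mul_of_nonneg_left ?_ (hp b)
          refine (abs_exp_sub_exp_le (le_of_abs_le (hx a)) (le_of_abs_le (hx b))).trans ?_
          refine mul_le_mul_of_nonneg_left ?_ (Real.exp_pos _).le
          have := abs_sub (x a) (x b)
          linarith [hx a, hx b]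
      _ = _ := by rw [← Finset.sum_mul, hs, one_mul]
  calc _ ≤ ∑ a, p a * (2 * X * Real.exp (2 * X)) := by
        refine Finset.sum_le_sum fun a _ => ?_
        have h3 : p a * Real.exp (x a) / Z - p a = p a * ((Real.exp (x a) - Z) * Z⁻¹) := by
          field_simp
        rw [h3, abs_mul, abs_of_nonneg (hp a), abs_mul, abs_of_pos (inv_pos.2 h0)]
        refine mul_le_mul_of_nonneg_left ?_ (hp a)
        calc |Real.exp (x a) - Z| * Z⁻¹ ≤ Real.exp X * (2 * X) * Real.exp X :=
              mul_le_mul (h2 a) hi (inv_pos.2 h0).le ((abs_nonneg _).trans (h2 a))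
          _ = 2 * X * Real.exp (2 * X) := by
            rw [two_mul X, Real.exp_add]
            ring
    _ = _ := by rw [← Finset.sum_mul, hs, one_mul]

/-- As `f` has mean zero, `exp` may be replaced by `exp - 1`, which is of first order in the
increment. -/
theorem sum_tilt_mul_le {f : A → ℝ} {c : ℝ} (hp : ∀ a, 0 ≤ p a) (hs : ∑ a, p a = 1)
    (hf : ∑ a, p a * f a = 0) (hc : 0 ≤ c) (hX : ∀ a, |c * (p a * f a)| ≤ X) :
    ∑ a, p a * Real.exp (c * (p a * f a)) / (∑ b, p b * Real.exp (c * (p b * f b))) * f a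
      ≤ Real.exp (2 * X) * (c * ∑ a, (p a * f a) ^ 2) := by
  have hi := inv_tilt_normalizer_le hp hs hX
  obtain ⟨h1, -⟩ := tilt_normalizer_mem hp hs hX
  set Z := ∑ b, p b * Real.exp (c * (p b * f b)) with hZ
  have h0 : 0 < Z := (Real.exp_pos (-X)).trans_le h1
  have h2 : ∑ a, p a * Real.exp (c * (p a * f a)) / Z * f a
      = Z⁻¹ * ∑ a, p a * (f a * (Real.exp (c * (p a * f a)) - 1)) := by
    have h3 : ∑ a, p a * (f a * (Real.exp (c * (p a * f a)) - 1))
        = ∑ a, p a * (f a * Real.exp (c * (p a * f a))) := by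
      simp only [mul_sub, mul_one, Finset.sum_sub_distrib, hf, sub_zero]
    rw [h3, Finset.mul_sum]
    exact Finset.sum_congr rfl fun _ _ => by ring
  have h3 : ∑ a, p a * (f a * (Real.exp (c * (p a * f a)) - 1))
      ≤ Real.exp X * (c * ∑ a, (p a * f a) ^ 2) := by
    rw [Finset.mul_sum, Finset.mul_sum]
    refine Finset.sum_le_sum fun a _ => ?_
    have hX0 : 0 ≤ X := (abs_nonneg _).trans (hX a)
    have h4 := abs_exp_sub_exp_le (le_of_abs_le (hX a)) hX0
    rw [Real.exp_zero, sub_zero] at h4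
    calc p a * (f a * (Real.exp (c * (p a * f a)) - 1))
        ≤ p a * (|f a| * (Real.exp X * |c * (p a * f a)|)) := by
          refine mul_le_mul_of_nonneg_left ?_ (hp a)
          refine (le_abs_self _).trans ?_
          rw [abs_mul]
          exact mul_le_mul_of_nonneg_left h4 (abs_nonneg _)
      _ = Real.exp X * (c * (p a * f a) ^ 2) := by
          rw [abs_mul, abs_mul, abs_of_nonneg hc, abs_of_nonneg (hp a), mul_pow, ← sq_abs (f a)]
          ring
  have h5 : 0 ≤ c * ∑ a, (p a * f a) ^ 2 :=
    mul_nonneg hc (Finset.sum_nonneg fun _ _ => sq_nonneg _)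
  rw [h2]
  calc _ ≤ Z⁻¹ * (Real.exp X * (c * ∑ a, (p a * f a) ^ 2)) :=
        mul_le_mul_of_nonneg_left h3 (inv_pos.2 h0).le
    _ ≤ Real.exp X * (Real.exp X * (c * ∑ a, (p a * f a) ^ 2)) :=
        mul_le_mul_of_nonneg_right hi (mul_nonneg (Real.exp_pos _).le h5)
    _ = _ := by
        rw [two_mul X, Real.exp_add]
        ring

theorem sum_erase_abs_mul_le [DecidableEq A] {f : A → ℝ} {H : ℝ} (hp : ∀ a, 0 ≤ p a)
    (hs : ∑ a, p a = 1) (hH : ∀ a, |f a| ≤ H) (b : A) :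
    ∑ a ∈ Finset.univ.erase b, |p a * f a| ≤ H * (1 - p b) := by
  have h1 : ∑ a ∈ Finset.univ.erase b, p a = 1 - p b := by
    rw [← hs, ← Finset.add_sum_erase _ _ (Finset.mem_univ b)]
    ring
  rw [← h1, Finset.mul_sum]
  refine Finset.sum_le_sum fun a _ => ?_
  rw [abs_mul, abs_of_nonneg (hp a), mul_comm]
  exact mul_le_mul_of_nonneg_right (hH a) (hp a)

/-- Zero mean makes the term at `b` minus the sum of the others, whose total mass is only `1 - p b`.
-/
theorem abs_self_mul_le [DecidableEq A] {f : A → ℝ} {H : ℝ} (hp : ∀ a, 0 ≤ p a)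
    (hs : ∑ a, p a = 1) (hf : ∑ a, p a * f a = 0) (hH : ∀ a, |f a| ≤ H) (b : A) :
    |p b * f b| ≤ H * (1 - p b) := by
  have h1 : p b * f b = -∑ a ∈ Finset.univ.erase b, p a * f a := by
    rw [← Finset.add_sum_erase _ _ (Finset.mem_univ b)] at hf
    linarith
  rw [h1, abs_neg]
  exact (Finset.abs_sum_le_sum_abs _ _).trans (sum_erase_abs_mul_le hp hs hH b)

theorem abs_mul_le_of_sum_eq_zero {f : A → ℝ} {H : ℝ} (hp : ∀ a, 0 ≤ p a) (hs : ∑ a, p a = 1)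
    (hf : ∑ a, p a * f a = 0) (hH : ∀ a, |f a| ≤ H) (b a : A) :
    |p a * f a| ≤ H * (1 - p b) := by
  classical
  by_cases h : a = b
  · subst h
    exact abs_self_mul_le hp hs hf hH a
  · exact (Finset.single_le_sum (f := fun a => |p a * f a|) (fun a _ => abs_nonneg _)
      (Finset.mem_erase.2 ⟨h, Finset.mem_univ a⟩)).trans (sum_erase_abs_mul_le hp hs hH b)

/-- One half of the bound covers the term at `b`, the other all remaining terms, through sum of
squares ≤ square of the sum; again no cardinality appears. -/
theorem sum_sq_mul_le {f : A → ℝ} {H : ℝ} (hp : ∀ a, 0 ≤ p a) (hs : ∑ a, p a = 1)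
    (hf : ∑ a, p a * f a = 0) (hH : ∀ a, |f a| ≤ H) (b : A) :
    ∑ a, (p a * f a) ^ 2 ≤ 2 * (H * (1 - p b)) ^ 2 := by
  classical
  have h1 := abs_self_mul_le hp hs hf hH b
  have h2 := sum_erase_abs_mul_le hp hs hH b
  have h3 : ∑ a ∈ Finset.univ.erase b, (p a * f a) ^ 2
      ≤ (∑ a ∈ Finset.univ.erase b, |p a * f a|) ^ 2 := by
    simp only [← sq_abs (p _ * f _)]
    exact Finset.sum_sq_le_sq_sum_of_nonneg fun _ _ => abs_nonneg _
  have h4 : 0 ≤ ∑ a ∈ Finset.univ.erase b, |p a * f a| :=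
    Finset.sum_nonneg fun _ _ => abs_nonneg _
  rw [← Finset.add_sum_erase _ _ (Finset.mem_univ b), two_mul]
  refine add_le_add ?_ (h3.trans (pow_le_pow_left₀ h4 h2 2))
  rw [← sq_abs (p b * f b)]
  exact pow_le_pow_left₀ (abs_nonneg _) h1 2

end Tilt

/-! ### The scalar recursion -/

/-- A positive sequence that decreases at most quadratically when it is small, and does not drop to
zero in one step when it is large, is eventually at least `1 / (K t)`. -/
theorem eventually_inv_mul_le_of_quadratic_decrease {d : ℕ → ℝ} {c K ε ε' : ℝ}
    (hd : ∀ t, 1 ≤ t → 0 < d t) (hc : 0 ≤ c) (hε' : 0 < ε') (hcε : c * ε ≤ 1 / 6)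
    (hcK : 6 / 5 * c < K)
    (hsmall : ∀ t, 1 ≤ t → d t ≤ ε → d t - c * d t ^ 2 ≤ d (t + 1))
    (hlarge : ∀ t, 1 ≤ t → ε ≤ d t → ε' ≤ d (t + 1)) :
    ∃ T : ℕ, 1 ≤ T ∧ ∀ t : ℕ, T ≤ t → 1 / (K * t) ≤ d t := by
  have hb : ∀ t, 1 ≤ t → (d t)⁻¹ ≤ max (d 1)⁻¹ ε'⁻¹ + 6 / 5 * c * t := by
    intro t ht
    induction t, ht using Nat.le_induction with
    | base =>
      have := le_max_left (d 1)⁻¹ ε'⁻¹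
      push_cast
      linarith
    | succ t ht ih =>
      push_cast
      rcases le_total (d t) ε with h | h
      · have h0 := hd t ht
        have h1 := hsmall t ht h
        have hu : c * d t ≤ 1 / 6 := (mul_le_mul_of_nonneg_left h hc).trans hcε
        have hpos : 0 < d t - c * d t ^ 2 := by nlinarith
        -- This is `1 / (1 - u) ≤ 1 + 6 u / 5` for `0 ≤ u ≤ 1 / 6`, with `u = c * d t`.
        have h2 : (d (t + 1))⁻¹ ≤ (d t)⁻¹ + 6 / 5 * c := by
          refine (inv_anti₀ hpos h1).trans ?_
          rw [inv_le_iff_one_le_mul₀ hpos]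
          have h3 : ((d t)⁻¹ + 6 / 5 * c) * (d t - c * d t ^ 2)
              = 1 + c * d t / 5 * (1 - 6 * (c * d t)) := by
            field_simp
            ring
          rw [h3]
          have : 0 ≤ c * d t / 5 * (1 - 6 * (c * d t)) :=
            mul_nonneg (by positivity) (by linarith)
          linarith
        linarith
      · have h1 := inv_anti₀ hε' (hlarge t ht h)
        have h2 := le_max_right (d 1)⁻¹ ε'⁻¹
        have h3 : 0 ≤ 6 / 5 * c * ((t : ℝ) + 1) := by positivity
        linarith
  -- From this time on the slack `(K - 6 / 5 * c) * t` absorbs the additive constant.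
  obtain ⟨N, hN⟩ := exists_nat_gt (max (d 1)⁻¹ ε'⁻¹ / (K - 6 / 5 * c))
  refine ⟨max N 1, le_max_right _ _, fun t ht => ?_⟩
  have ht1 : 1 ≤ t := (le_max_right _ _).trans ht
  have htN : (N : ℝ) ≤ t := by exact_mod_cast (le_max_left _ _).trans ht
  have hK : 0 < K - 6 / 5 * c := by linarith
  have h1 := (div_lt_iff₀ hK).1 (hN.trans_le htN)
  have h2 : (d t)⁻¹ ≤ K * t := by linarith [hb t ht1]
  rw [one_div]
  exact inv_le_of_inv_le₀ (hd t ht1) h2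

end

noncomputable section

namespace FiniteMDP

/-! ### Suboptimality and the optimal value gap -/

section Optimal

variable {S A : Type*} [Fintype S] [Fintype A]

theorem sum_detPolicy_mul (f : S → A) (s : S) (g : A → ℝ) :
    ∑ a, (detPolicy f s).1 a * g a = g (f s) := by
  classical
  simp [detPolicy, Pi.single_apply]

variable {M : FiniteMDP S A} {astar : S → A}

theorem optValue_eq (hopt : M.IsOptimal (detPolicy astar)) :
    M.optValue = M.value (detPolicy astar) := by
  funext s
  have : Nonempty (Policy S A) := ⟨detPolicy astar⟩
  exact le_antisymm (ciSup_le fun π => hopt π s)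
    (le_ciSup (f := fun π => M.value π s) ⟨_, Set.forall_mem_range.2 fun π => hopt π s⟩ _)

theorem valueFrom_le (hopt : M.IsOptimal (detPolicy astar)) (π : Policy S A)
    (μ : stdSimplex ℝ S) : M.valueFrom π μ ≤ M.valueFrom (detPolicy astar) μ :=
  Finset.sum_le_sum fun s _ => mul_le_mul_of_nonneg_left (hopt π s) (μ.2.1 s)

theorem optValueFrom_eq (hopt : M.IsOptimal (detPolicy astar)) (μ : stdSimplex ℝ S) :
    M.optValueFrom μ = M.valueFrom (detPolicy astar) μ := by
  have : Nonempty (Policy S A) := ⟨detPolicy astar⟩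
  exact le_antisymm (ciSup_le fun π => valueFrom_le hopt π μ)
    (le_ciSup (f := fun π => M.valueFrom π μ)
      ⟨_, Set.forall_mem_range.2 fun π => valueFrom_le hopt π μ⟩ _)

theorem optQ_eq (hopt : M.IsOptimal (detPolicy astar)) (s : S) (a : A) :
    M.optQ s a = M.qValue (detPolicy astar) s a := by
  rw [optQ, optValue_eq hopt, qValue, next]

theorem qValue_detPolicy (f : S → A) (s : S) :
    M.qValue (detPolicy f) s (f s) = M.value (detPolicy f) s := by
  rw [value_bellman, sum_detPolicy_mul]

/-- No single-state deviation improves on an optimal policy. -/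
theorem optQ_le (hopt : M.IsOptimal (detPolicy astar)) (s : S) (a : A) :
    M.optQ s a ≤ M.optQ s (astar s) := by
  classical
  rw [optQ_eq hopt, optQ_eq hopt, qValue_detPolicy]
  by_contra! h
  -- The deviation has zero advantage at all other states, so the difference is an occupancy at
  -- least `1` times a positive advantage.
  have h1 := M.value_sub_value (detPolicy (Function.update astar s a)) (detPolicy astar) s
  simp only [sum_detPolicy_mul] at h1
  rw [Finset.sum_eq_single s] at h1
  · rw [Function.update_self] at h1
    have h2 := hopt (detPolicy (Function.update astar s a)) s
    have h3 := M.one_le_occ_self (detPolicy (Function.update astar s a)) s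
    have h4 := mul_pos (lt_of_lt_of_le one_pos h3) (sub_pos.2 h)
    linarith
  · intro z _ hz
    rw [Function.update_of_ne hz, qValue_detPolicy, sub_self, mul_zero]
  · exact fun h => absurd (Finset.mem_univ s) h

theorem optGap_nonneg (hopt : M.IsOptimal (detPolicy astar)) : 0 ≤ M.optGap astar :=
  Real.iInf_nonneg fun p => sub_nonneg.2 (optQ_le hopt p.1.1 p.1.2)

theorem optGap_le (M : FiniteMDP S A) {astar : S → A} {s : S} {a : A} (h : a ≠ astar s) :
    M.optGap astar ≤ M.optQ s (astar s) - M.optQ s a :=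
  ciInf_le (Set.finite_range _).bddBelow
    (⟨(s, a), h⟩ : {p : S × A // p.2 ≠ astar p.1})

/-- A Bellman equation for the suboptimality, with action gaps as running costs. For an optimal
policy these are nonnegative, so lower bounds on action probabilities can be propagated through it.
-/
theorem value_sub_eq_sum_gap (hopt : M.IsOptimal (detPolicy astar)) (π : Policy S A) (s : S) :
    M.value (detPolicy astar) s - M.value π s =
      ∑ a, (π s).1 a * ((M.optQ s (astar s) - M.optQ s a) +
        M.γ * M.next s a (fun z => M.value (detPolicy astar) z - M.value π z)) := by
  have h1 : ∀ a, (M.optQ s (astar s) - M.optQ s a) +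
      M.γ * M.next s a (fun z => M.value (detPolicy astar) z - M.value π z)
      = M.value (detPolicy astar) s - M.qValue π s a := fun a => by
    rw [next_sub, optQ_eq hopt, optQ_eq hopt, qValue_detPolicy, qValue, qValue]
    ring
  simp only [h1, mul_sub, Finset.sum_sub_distrib, ← Finset.sum_mul, policy_sum, one_mul,
    ← value_bellman]

theorem valueFrom_sub_eq_sum_gap (hopt : M.IsOptimal (detPolicy astar)) (π : Policy S A)
    (μ : stdSimplex ℝ S) :
    M.valueFrom (detPolicy astar) μ - M.valueFrom π μ =
      ∑ s, M.occFrom π μ s * ∑ a, (π s).1 a * (M.optQ s (astar s) - M.optQ s a) := by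
  rw [← neg_sub, valueFrom_sub_valueFrom, ← Finset.sum_neg_distrib]
  refine Finset.sum_congr rfl fun s _ => ?_
  rw [← mul_neg, ← Finset.sum_neg_distrib]
  congr 1
  refine Finset.sum_congr rfl fun a _ => ?_
  rw [optQ_eq hopt, optQ_eq hopt, qValue_detPolicy]
  ring

theorem optGap_mul_le_sum_gap (M : FiniteMDP S A) (astar : S → A) (π : Policy S A) (s : S) :
    M.optGap astar * (1 - (π s).1 (astar s)) ≤
      ∑ a, (π s).1 a * (M.optQ s (astar s) - M.optQ s a) := by
  classical
  have h1 : ∑ a ∈ Finset.univ.erase (astar s), (π s).1 a = 1 - (π s).1 (astar s) := by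
    rw [← policy_sum π s, ← Finset.add_sum_erase _ _ (Finset.mem_univ (astar s))]
    ring
  rw [← h1, ← Finset.add_sum_erase _ _ (Finset.mem_univ (astar s)), sub_self, mul_zero, zero_add,
    Finset.mul_sum]
  refine Finset.sum_le_sum fun a ha => ?_
  rw [mul_comm]
  exact mul_le_mul_of_nonneg_left (M.optGap_le (Finset.ne_of_mem_erase ha)) (policy_nonneg π s a)

theorem optGap_mul_sum_le (hopt : M.IsOptimal (detPolicy astar)) (π : Policy S A)
    (μ : stdSimplex ℝ S) :
    M.optGap astar * ∑ s, M.occFrom π μ s * (1 - (π s).1 (astar s)) ≤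
      M.valueFrom (detPolicy astar) μ - M.valueFrom π μ := by
  rw [valueFrom_sub_eq_sum_gap hopt, Finset.mul_sum]
  refine Finset.sum_le_sum fun s _ => ?_
  rw [mul_left_comm]
  exact mul_le_mul_of_nonneg_left (M.optGap_mul_le_sum_gap astar π s) (M.occFrom_nonneg π μ s)

theorem policy_le_one (π : Policy S A) (s : S) (a : A) : (π s).1 a ≤ 1 := by
  rw [← policy_sum π s]
  exact Finset.single_le_sum (fun a _ => policy_nonneg π s a) (Finset.mem_univ a)

/-- A state charged by `μ` has positive occupancy, and there a fully supported policy puts mass on a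
suboptimal action. -/
theorem valueFrom_lt [Nontrivial A] (hopt : M.IsOptimal (detPolicy astar))
    (hgap : 0 < M.optGap astar) {π : Policy S A} (hπ : ∀ s a, 0 < (π s).1 a)
    (μ : stdSimplex ℝ S) : M.valueFrom π μ < M.valueFrom (detPolicy astar) μ := by
  obtain ⟨s, hs⟩ : ∃ s, 0 < μ.1 s := by
    by_contra! h
    have h1 : ∑ s, μ.1 s ≤ 0 := Finset.sum_nonpos fun s _ => h s
    rw [μ.2.2] at h1
    linarith
  have hy : 0 < 1 - (π s).1 (astar s) := by
    obtain ⟨b, hb⟩ := exists_ne (astar s)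
    have h1 := Finset.add_le_sum (f := (π s).1) (fun a _ => policy_nonneg π s a)
      (Finset.mem_univ b) (Finset.mem_univ (astar s)) hb
    rw [policy_sum] at h1
    linarith [hπ s b]
  have hD : 0 < M.occFrom π μ s := by
    have h1 : μ.1 s * M.occ π s s ≤ M.occFrom π μ s :=
      Finset.single_le_sum (f := fun z => μ.1 z * M.occ π z s)
        (fun z _ => mul_nonneg (μ.2.1 z) (M.occ_nonneg π z s)) (Finset.mem_univ s)
    exact (mul_pos hs (lt_of_lt_of_le one_pos (M.one_le_occ_self π s))).trans_le h1
  have h2 : M.occFrom π μ s * (1 - (π s).1 (astar s)) ≤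
      ∑ s, M.occFrom π μ s * (1 - (π s).1 (astar s)) :=
    Finset.single_le_sum (f := fun s => M.occFrom π μ s * (1 - (π s).1 (astar s)))
      (fun z _ => mul_nonneg (M.occFrom_nonneg π μ z) (sub_nonneg.2 (policy_le_one π z _)))
      (Finset.mem_univ s)
  have h3 := optGap_mul_sum_le hopt π μ
  have h4 := mul_pos hgap ((mul_pos hD hy).trans_le h2)
  linarith

/-- Scaling all action probabilities by at least `κ` cannot annihilate the suboptimality. -/
theorem pow_mul_le_value_sub (hr : ∀ s a, M.r s a ∈ Set.Icc (0 : ℝ) 1)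
    (hopt : M.IsOptimal (detPolicy astar)) {π π' : Policy S A} {κ : ℝ} (hκ0 : 0 ≤ κ) (hκ1 : κ ≤ 1)
    (hκ : ∀ s a, κ * (π s).1 a ≤ (π' s).1 a) (N : ℕ) (s : S) :
    κ ^ N * (M.value (detPolicy astar) s - M.value π s - M.γ ^ N * M.horizon) ≤
      M.value (detPolicy astar) s - M.value π' s := by
  induction N generalizing s with
  | zero =>
    have h1 := hopt π' s
    have h2 := (M.value_mem hr (detPolicy astar) s).2
    have h3 := (M.value_mem hr π s).1
    simp only [pow_zero, one_mul]
    linarith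
  | succ N ih =>
    have hg : ∀ a, 0 ≤ M.optQ s (astar s) - M.optQ s a := fun a => sub_nonneg.2 (optQ_le hopt s a)
    have hn : ∀ a, 0 ≤ M.next s a (fun z => M.value (detPolicy astar) z - M.value π' z) := by
      intro a
      rw [← M.next_const s a 0]
      exact M.next_mono s a fun z => sub_nonneg.2 (hopt π' z)
    -- The tail allowance is constant in the state, so it passes through the expectation and loses
    -- one factor `γ`.
    have h1 : M.value (detPolicy astar) s - M.value π s - M.γ ^ (N + 1) * M.horizon =
        ∑ a, (π s).1 a * ((M.optQ s (astar s) - M.optQ s a) + M.γ * M.next s a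
          (fun z => M.value (detPolicy astar) z - M.value π z - M.γ ^ N * M.horizon)) := by
      simp only [M.next_sub s _ (fun z => M.value (detPolicy astar) z - M.value π z)
        (fun _ => M.γ ^ N * M.horizon), next_const]
      rw [value_sub_eq_sum_gap hopt]
      simp only [mul_sub, mul_add, Finset.sum_sub_distrib, Finset.sum_add_distrib,
        ← Finset.sum_mul, policy_sum, one_mul]
      ring
    rw [h1, value_sub_eq_sum_gap hopt π', Finset.mul_sum]
    refine Finset.sum_le_sum fun a _ => ?_
    have h2 : κ ^ N * M.next s a
        (fun z => M.value (detPolicy astar) z - M.value π z - M.γ ^ N * M.horizon)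
        ≤ M.next s a (fun z => M.value (detPolicy astar) z - M.value π' z) := by
      rw [← next_smul]
      exact M.next_mono s a ih
    have h3 : κ ^ N * (M.optQ s (astar s) - M.optQ s a) ≤ M.optQ s (astar s) - M.optQ s a :=
      mul_le_of_le_one_left (hg a) (pow_le_one₀ hκ0 hκ1)
    have h4 := mul_le_mul_of_nonneg_left h2 M.γ_nonneg
    calc _ = κ * (π s).1 a * (κ ^ N * (M.optQ s (astar s) - M.optQ s a) + M.γ * (κ ^ N * M.next s a
          (fun z => M.value (detPolicy astar) z - M.value π z - M.γ ^ N * M.horizon))) := by ring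
      _ ≤ κ * (π s).1 a * ((M.optQ s (astar s) - M.optQ s a) +
          M.γ * M.next s a (fun z => M.value (detPolicy astar) z - M.value π' z)) :=
        mul_le_mul_of_nonneg_left (add_le_add h3 h4) (mul_nonneg hκ0 (policy_nonneg π s a))
      _ ≤ _ := mul_le_mul_of_nonneg_right (hκ s a)
        (add_nonneg (hg a) (mul_nonneg M.γ_nonneg (hn a)))

theorem pow_mul_le_valueFrom_sub (hr : ∀ s a, M.r s a ∈ Set.Icc (0 : ℝ) 1)
    (hopt : M.IsOptimal (detPolicy astar)) {π π' : Policy S A} {κ : ℝ} (hκ0 : 0 ≤ κ) (hκ1 : κ ≤ 1)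
    (hκ : ∀ s a, κ * (π s).1 a ≤ (π' s).1 a) (N : ℕ) (μ : stdSimplex ℝ S) :
    κ ^ N * (M.valueFrom (detPolicy astar) μ - M.valueFrom π μ - M.γ ^ N * M.horizon) ≤
      M.valueFrom (detPolicy astar) μ - M.valueFrom π' μ := by
  have h1 : κ ^ N * (M.valueFrom (detPolicy astar) μ - M.valueFrom π μ - M.γ ^ N * M.horizon)
      = ∑ s, μ.1 s * (κ ^ N *
        (M.value (detPolicy astar) s - M.value π s - M.γ ^ N * M.horizon)) := by
    have h2 : ∑ s, μ.1 s * (κ ^ N * (M.γ ^ N * M.horizon)) = κ ^ N * (M.γ ^ N * M.horizon) := by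
      rw [← Finset.sum_mul, μ.2.2, one_mul]
    rw [valueFrom_sub, mul_sub, ← h2, Finset.mul_sum, ← Finset.sum_sub_distrib]
    exact Finset.sum_congr rfl fun _ _ => by ring
  rw [h1, valueFrom_sub]
  exact Finset.sum_le_sum fun s _ =>
    mul_le_mul_of_nonneg_left (pow_mul_le_value_sub hr hopt hκ0 hκ1 hκ N s) (μ.2.1 s)

end Optimal

/-! ### The effect of one gradient step -/

section Step

variable {S A : Type*} [Fintype S] [Fintype A] [Nonempty A] {M : FiniteMDP S A} {astar : S → A}

theorem softmaxPolicy_gradient_step (M : FiniteMDP S A) (μ : stdSimplex ℝ S)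
    (θ : EuclideanSpace ℝ (S × A)) (η : ℝ) (s : S) (a : A) :
    (softmaxPolicy (θ + η • M.softmaxGradient μ θ) s).1 a =
      (softmaxPolicy θ s).1 a * Real.exp ((η * M.occFrom (softmaxPolicy θ) μ s) *
        ((softmaxPolicy θ s).1 a * M.adv (softmaxPolicy θ) s a)) /
      ∑ b, (softmaxPolicy θ s).1 b * Real.exp ((η * M.occFrom (softmaxPolicy θ) μ s) *
        ((softmaxPolicy θ s).1 b * M.adv (softmaxPolicy θ) s b)) := by
  rw [softmaxPolicy_add]
  simp only [PiLp.smul_apply, softmaxGradient, smul_eq_mul, mul_assoc]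

theorem abs_gradient_step_le (hr : ∀ s a, M.r s a ∈ Set.Icc (0 : ℝ) 1) (astar : S → A)
    (μ : stdSimplex ℝ S) (π : Policy S A) {η : ℝ} (hη0 : 0 ≤ η) (hη1 : η ≤ 1) (s : S) (a : A) :
    |(η * M.occFrom π μ s) * ((π s).1 a * M.adv π s a)| ≤
      M.horizon * (M.occFrom π μ s * (1 - (π s).1 (astar s))) := by
  have hD := M.occFrom_nonneg π μ s
  have h1 := abs_mul_le_of_sum_eq_zero (policy_nonneg π s) (policy_sum π s)
    (M.sum_policy_mul_adv π s) (M.abs_adv_le hr π s) (astar s) a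
  rw [abs_mul, abs_of_nonneg (mul_nonneg hη0 hD)]
  calc _ ≤ M.occFrom π μ s * (M.horizon * (1 - (π s).1 (astar s))) :=
        mul_le_mul (mul_le_of_le_one_left hD hη1) h1 (abs_nonneg _) hD
    _ = _ := by ring

/-- A gradient step increases the value by at most a multiple of the squared suboptimality. -/
theorem valueFrom_gradient_step_sub_le (hr : ∀ s a, M.r s a ∈ Set.Icc (0 : ℝ) 1)
    (astar : S → A) (μ : stdSimplex ℝ S) (θ : EuclideanSpace ℝ (S × A)) {η E : ℝ}
    (hη0 : 0 ≤ η) (hη1 : η ≤ 1)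
    (hE : ∑ s, M.occFrom (softmaxPolicy θ) μ s * (1 - (softmaxPolicy θ s).1 (astar s)) ≤ E) :
    M.valueFrom (softmaxPolicy (θ + η • M.softmaxGradient μ θ)) μ
      - M.valueFrom (softmaxPolicy θ) μ
      ≤ 6 * Real.exp (4 * (M.horizon * E)) * M.horizon ^ 5 * E ^ 2 := by
  set π := softmaxPolicy θ with hπ
  set π' := softmaxPolicy (θ + η • M.softmaxGradient μ θ) with hπ'
  set H := M.horizon with hH
  have hH1 : 1 ≤ H := M.one_le_horizon
  have hH0 : 0 < H := M.horizon_pos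
  set D := M.occFrom π μ with hD
  set D' := M.occFrom π' μ with hD'
  set y : S → ℝ := fun s => 1 - (π s).1 (astar s) with hy
  have hD0 : ∀ s, 0 ≤ D s := M.occFrom_nonneg π μ
  have hD'0 : ∀ s, 0 ≤ D' s := M.occFrom_nonneg π' μ
  have hy0 : ∀ s, 0 ≤ y s := fun s => sub_nonneg.2 (policy_le_one π s _)
  have hy1 : ∀ s, y s ≤ 1 := fun s => sub_le_self _ (policy_nonneg π s _)
  have hDy0 : ∀ s, 0 ≤ D s * y s := fun s => mul_nonneg (hD0 s) (hy0 s)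
  have hDyE : ∀ s, D s * y s ≤ E := fun s =>
    (Finset.single_le_sum (f := fun s => D s * y s) (fun s _ => hDy0 s)
      (Finset.mem_univ s)).trans hE
  have hE0 : 0 ≤ E := (Finset.sum_nonneg fun s _ => hDy0 s).trans hE
  set B := Real.exp (2 * (H * E)) with hB
  have hB1 : 1 ≤ B := Real.one_le_exp (by positivity)
  have hB0 : 0 < B := Real.exp_pos _
  have hx : ∀ s a, |(η * D s) * ((π s).1 a * M.adv π s a)| ≤ H * (D s * y s) := fun s a =>
    abs_gradient_step_le hr astar μ π hη0 hη1 s a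
  have hXE : ∀ s, H * (D s * y s) ≤ H * E := fun s => mul_le_mul_of_nonneg_left (hDyE s) hH0.le
  have hstep : ∀ s a, (π' s).1 a = (π s).1 a * Real.exp ((η * D s) * ((π s).1 a * M.adv π s a)) /
      ∑ b, (π s).1 b * Real.exp ((η * D s) * ((π s).1 b * M.adv π s b)) := fun s a =>
    M.softmaxPolicy_gradient_step μ θ η s a
  have hl1 : ∀ s, ∑ a, |(π' s).1 a - (π s).1 a| ≤ 2 * (H * (D s * y s)) * B := by
    intro s
    have h1 := sum_abs_tilt_sub_le (policy_nonneg π s) (policy_sum π s) (hx s)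
    simp only [← hstep] at h1
    refine h1.trans (mul_le_mul_of_nonneg_left (Real.exp_le_exp.2 ?_) ?_)
    · linarith [hXE s]
    · have := hDy0 s
      positivity
  -- The resolvent identity: one `H` bounds `D z`, one bounds `D'` inside it, and one comes from the
  -- advantages.
  have hocc : ∀ s, D' s ≤ D s + 2 * B * H ^ 3 * E := by
    intro s
    have h1 : D' s - D s ≤ ∑ z, D z * (2 * (H * (D z * y z)) * B * H) := by
      rw [hD', hD, occFrom_sub_occFrom]
      refine Finset.sum_le_sum fun z _ => mul_le_mul_of_nonneg_left ?_ (hD0 z)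
      refine le_trans ?_ (mul_le_mul_of_nonneg_right (hl1 z) hH0.le)
      rw [Finset.sum_mul]
      refine Finset.sum_le_sum fun a _ => ?_
      have hn0 : 0 ≤ M.next z a (fun s' => M.occ π' s' s) := by
        rw [← M.next_const z a 0]
        exact M.next_mono z a fun s' => M.occ_nonneg π' s' s
      have hn1 : M.next z a (fun s' => M.occ π' s' s) ≤ H := by
        rw [← M.next_const z a H]
        exact M.next_mono z a fun s' => M.occ_le π' s' s
      have hn2 : M.γ * M.next z a (fun s' => M.occ π' s' s) ≤ H :=
        (mul_le_of_le_one_left hn0 M.γ_lt_one.le).trans hn1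
      exact mul_le_mul (le_abs_self _) hn2 (mul_nonneg M.γ_nonneg hn0) (abs_nonneg _)
    have h2 : ∑ z, D z * (2 * (H * (D z * y z)) * B * H) ≤ 2 * B * H ^ 3 * E := by
      calc _ ≤ ∑ z, H * (2 * (H * (D z * y z)) * B * H) := by
            refine Finset.sum_le_sum fun z _ => mul_le_mul_of_nonneg_right (M.occFrom_le π μ z) ?_
            have := hDy0 z
            positivity
        _ = 2 * B * H ^ 3 * ∑ z, D z * y z := by
            rw [Finset.mul_sum]
            exact Finset.sum_congr rfl fun _ _ => by ring
        _ ≤ _ := mul_le_mul_of_nonneg_left hE (by positivity)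
    linarith
  have hinc : ∀ s, ∑ a, (π' s).1 a * M.adv π s a ≤ B * (D s * (2 * (H * y s) ^ 2)) := by
    intro s
    have h1 := sum_tilt_mul_le (policy_nonneg π s) (policy_sum π s) (M.sum_policy_mul_adv π s)
      (mul_nonneg hη0 (hD0 s)) (hx s)
    simp only [← hstep] at h1
    refine h1.trans (mul_le_mul (Real.exp_le_exp.2 (by linarith [hXE s])) ?_ ?_ hB0.le)
    · exact mul_le_mul (mul_le_of_le_one_left (hD0 s) hη1)
        (sum_sq_mul_le (policy_nonneg π s) (policy_sum π s) (M.sum_policy_mul_adv π s)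
          (M.abs_adv_le hr π s) (astar s)) (Finset.sum_nonneg fun _ _ => sq_nonneg _) (hD0 s)
    · exact mul_nonneg (mul_nonneg hη0 (hD0 s)) (Finset.sum_nonneg fun _ _ => sq_nonneg _)
  have hsq : ∑ s, (D s * y s) ^ 2 ≤ E ^ 2 :=
    (Finset.sum_sq_le_sq_sum_of_nonneg fun s _ => hDy0 s).trans
      (pow_le_pow_left₀ (Finset.sum_nonneg fun s _ => hDy0 s) hE 2)
  have hB2 : Real.exp (4 * (H * E)) = B * B := by
    rw [hB, ← Real.exp_add]
    ring_nf
  have hH3 : 1 ≤ H ^ 3 := one_le_pow₀ hH1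
  rw [valueFrom_sub_valueFrom]
  calc ∑ s, D' s * ∑ a, (π' s).1 a * M.adv π s a
      ≤ ∑ s, (2 * B * H ^ 2 * (D s * y s) ^ 2
          + 2 * B * H ^ 2 * (2 * B * H ^ 3 * E) * (D s * y s)) := by
        refine Finset.sum_le_sum fun s _ => ?_
        have h3 : 0 ≤ B * (D s * (2 * (H * y s) ^ 2)) := by
          have := hD0 s
          positivity
        refine (mul_le_mul_of_nonneg_left (hinc s) (hD'0 s)).trans
          ((mul_le_mul_of_nonneg_right (hocc s) h3).trans ?_)
        -- The correction term already carries a factor `E`, so one of the two factors `y s` can be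
        -- dropped.
        have h4 : 2 * B * H ^ 2 * (2 * B * H ^ 3 * E) * (D s * y s) * y s
            ≤ 2 * B * H ^ 2 * (2 * B * H ^ 3 * E) * (D s * y s) :=
          mul_le_of_le_one_right (mul_nonneg (by positivity) (hDy0 s)) (hy1 s)
        nlinarith [h4]
    _ = 2 * B * H ^ 2 * ∑ s, (D s * y s) ^ 2
          + 2 * B * H ^ 2 * (2 * B * H ^ 3 * E) * ∑ s, D s * y s := by
        rw [Finset.sum_add_distrib, Finset.mul_sum, Finset.mul_sum]
    _ ≤ 2 * B * H ^ 2 * E ^ 2 + 2 * B * H ^ 2 * (2 * B * H ^ 3 * E) * E :=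
        add_le_add (mul_le_mul_of_nonneg_left hsq (by positivity))
          (mul_le_mul_of_nonneg_left hE (by positivity))
    _ ≤ 6 * Real.exp (4 * (H * E)) * H ^ 5 * E ^ 2 := by
        rw [hB2]
        have h5 : 2 * B * H ^ 2 * E ^ 2 * 1 ≤ 2 * B * H ^ 2 * E ^ 2 * (B * H ^ 3) :=
          mul_le_mul_of_nonneg_left (one_le_mul_of_one_le_of_one_le hB1 hH3) (by positivity)
        linarith [h5, show 2 * B * H ^ 2 * E ^ 2 * (B * H ^ 3) = 2 * (B * B) * H ^ 5 * E ^ 2 by ring,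
          show 2 * B * H ^ 2 * (2 * B * H ^ 3 * E) * E = 4 * (B * B) * H ^ 5 * E ^ 2 by ring]

end Step

end FiniteMDP

end

/-! ### The two regimes of the suboptimality -/

noncomputable section

namespace FiniteMDP

variable {S A : Type*} [Fintype S] [Fintype A] [Nonempty A] {M : FiniteMDP S A} {astar : S → A}

/-- When the suboptimality is small, a gradient step decreases it at most quadratically. -/
theorem sub_quadratic_le_suboptimality_gradient_step (hr : ∀ s a, M.r s a ∈ Set.Icc (0 : ℝ) 1)
    (hopt : M.IsOptimal (detPolicy astar)) (hgap : 0 < M.optGap astar) (μ : stdSimplex ℝ S)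
    (θ : EuclideanSpace ℝ (S × A)) {η d : ℝ} (hη0 : 0 ≤ η) (hη1 : η ≤ 1)
    (hd : d = M.valueFrom (detPolicy astar) μ - M.valueFrom (softmaxPolicy θ) μ)
    (hsmall : d ≤ M.optGap astar / (12 * M.horizon)) :
    d - 9 * M.horizon ^ 5 / M.optGap astar ^ 2 * d ^ 2 ≤
      M.valueFrom (detPolicy astar) μ
        - M.valueFrom (softmaxPolicy (θ + η • M.softmaxGradient μ θ)) μ := by
  have hH0 := M.horizon_pos
  have h1 := optGap_mul_sum_le hopt (softmaxPolicy θ) μ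
  rw [← hd, mul_comm, ← le_div_iff₀ hgap] at h1
  have h2 := valueFrom_gradient_step_sub_le hr astar μ θ hη0 hη1 h1
  -- The threshold makes the exponent at most `1 / 3`; then `exp (1 / 3) ≤ 3 / 2` turns the constant
  -- `6` into `9`.
  have h3 : 4 * (M.horizon * (d / M.optGap astar)) ≤ 1 / 3 := by
    rw [le_div_iff₀ (by positivity)] at hsmall
    rw [← mul_div_assoc, ← mul_div_assoc, div_le_iff₀ hgap]
    linarith
  have h4 : Real.exp (4 * (M.horizon * (d / M.optGap astar))) ≤ 3 / 2 := by
    refine (Real.exp_le_exp.2 h3).trans ?_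
    have h5 := Real.add_one_le_exp (-(1 / 3))
    rw [Real.exp_neg, le_inv_comm₀ (by norm_num) (Real.exp_pos _)] at h5
    refine h5.trans ?_
    norm_num
  have h5 : 6 * Real.exp (4 * (M.horizon * (d / M.optGap astar))) * M.horizon ^ 5
      * (d / M.optGap astar) ^ 2 ≤ 9 * M.horizon ^ 5 / M.optGap astar ^ 2 * d ^ 2 := by
    calc _ = Real.exp (4 * (M.horizon * (d / M.optGap astar))) *
          (6 * M.horizon ^ 5 * (d / M.optGap astar) ^ 2) := by ring
      _ ≤ 3 / 2 * (6 * M.horizon ^ 5 * (d / M.optGap astar) ^ 2) :=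
        mul_le_mul_of_nonneg_right h4 (by positivity)
      _ = _ := by
        rw [div_pow]
        ring
  linarith

/-- When the suboptimality is large, a gradient step cannot make it arbitrarily small. -/
theorem exists_le_suboptimality_gradient_step (hr : ∀ s a, M.r s a ∈ Set.Icc (0 : ℝ) 1)
    (hopt : M.IsOptimal (detPolicy astar)) (μ : stdSimplex ℝ S) {ε : ℝ} (hε : 0 < ε) :
    ∃ ε' : ℝ, 0 < ε' ∧ ∀ (θ : EuclideanSpace ℝ (S × A)) (η : ℝ), 0 ≤ η → η ≤ 1 →
      ε ≤ M.valueFrom (detPolicy astar) μ - M.valueFrom (softmaxPolicy θ) μ →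
      ε' ≤ M.valueFrom (detPolicy astar) μ
        - M.valueFrom (softmaxPolicy (θ + η • M.softmaxGradient μ θ)) μ := by
  have hH0 := M.horizon_pos
  -- `N` is chosen so that the part beyond `N` moves accounts for less than `ε / 2`.
  obtain ⟨N, hN⟩ := exists_pow_lt_of_lt_one (show 0 < ε / (2 * M.horizon) by positivity) M.γ_lt_one
  rw [lt_div_iff₀ (by positivity)] at hN
  refine ⟨Real.exp (-(2 * (M.horizon * M.horizon))) ^ N * (ε / 2), by positivity,
    fun θ η hη0 hη1 h => ?_⟩
  -- Logits move by at most `H²`, since occupancies are at most `H`; numerator and normaliser each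
  -- cost a factor `exp (-H²)`.
  have hκ : ∀ s a, Real.exp (-(2 * (M.horizon * M.horizon))) * (softmaxPolicy θ s).1 a ≤
      (softmaxPolicy (θ + η • M.softmaxGradient μ θ) s).1 a := by
    intro s a
    rw [softmaxPolicy_gradient_step]
    refine exp_mul_le_tilt (x := fun b => (η * M.occFrom (softmaxPolicy θ) μ s) *
      ((softmaxPolicy θ s).1 b * M.adv (softmaxPolicy θ) s b))
      (policy_nonneg (softmaxPolicy θ) s) (policy_sum (softmaxPolicy θ) s) (fun b => ?_) a
    refine (abs_gradient_step_le hr astar μ (softmaxPolicy θ) hη0 hη1 s b).trans ?_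
    refine mul_le_mul_of_nonneg_left ?_ hH0.le
    refine (mul_le_of_le_one_right (M.occFrom_nonneg _ μ s) ?_).trans (M.occFrom_le _ μ s)
    exact sub_le_self _ (policy_nonneg _ s _)
  have hκ1 : Real.exp (-(2 * (M.horizon * M.horizon))) ≤ 1 :=
    Real.exp_le_one_iff.2 (neg_nonpos.2 (by positivity))
  refine le_trans ?_ (pow_mul_le_valueFrom_sub hr hopt (Real.exp_pos _).le hκ1 hκ N μ)
  exact mul_le_mul_of_nonneg_left (by linarith) (by positivity)

end FiniteMDP

end

/-! ### Assembly -/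

theorem mainTheorem7 {S A : Type*} [Fintype S] [Fintype A] [Nontrivial A]
    (M : FiniteMDP S A) (hr : ∀ s a, M.r s a ∈ Set.Icc (0 : ℝ) 1)
    (μ : stdSimplex ℝ S)
    (astar : S → A) (hopt : M.IsOptimal (detPolicy astar))
    (η : ℕ → ℝ) (hη : ∀ t : ℕ, 1 ≤ t → η t ∈ Set.Ioc (0 : ℝ) 1)
    (θ : ℕ → EuclideanSpace ℝ (S × A)) (hθ : M.IsPolicyGradientRun μ η θ) :
    ∃ T : ℕ, 1 ≤ T ∧ ∀ t : ℕ, T ≤ t →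
      (1 - M.γ) ^ 5 * M.optGap astar ^ 2 / (12 * (t : ℝ)) ≤
        M.optValueFrom μ - M.valueFrom (softmaxPolicy (θ t)) μ := by
  have hruns : ∀ t, 1 ≤ t → θ (t + 1) = θ t + η t • M.softmaxGradient μ (θ t) := fun t ht => by
    rw [hθ t ht, M.gradient_softmaxObjective hr]
  rw [FiniteMDP.optValueFrom_eq hopt]
  rcases (FiniteMDP.optGap_nonneg hopt).eq_or_lt with hgap | hgap
  · refine ⟨1, le_rfl, fun t _ => ?_⟩
    rw [← hgap]
    simpa using FiniteMDP.valueFrom_le hopt (softmaxPolicy (θ t)) μ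
  have hH0 := M.horizon_pos
  set g := M.optGap astar with hg
  set H := M.horizon with hH
  -- The first bound validates the quadratic recursion; the second gives `c * ε ≤ 1 / 6` for `c = 9
  -- * H ^ 5 / g ^ 2`.
  set ε := min (g / (12 * H)) (g ^ 2 / (54 * H ^ 5)) with hε
  have hε0 : 0 < ε := lt_min (by positivity) (by positivity)
  obtain ⟨ε', hε'0, hε'⟩ := FiniteMDP.exists_le_suboptimality_gradient_step hr hopt μ hε0
  have hcε : 9 * H ^ 5 / g ^ 2 * ε ≤ 1 / 6 := by
    refine (mul_le_mul_of_nonneg_left (min_le_right _ _) (by positivity)).trans_eq ?_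
    field_simp
    norm_num
  -- The slack between `54 / 5` and `12` is what lets `T` absorb the starting value.
  have hcK : 6 / 5 * (9 * H ^ 5 / g ^ 2) < 12 * H ^ 5 / g ^ 2 := by
    have : 0 < H ^ 5 / g ^ 2 := by positivity
    rw [mul_div_assoc, mul_div_assoc]
    linarith
  obtain ⟨T, hT, h⟩ := eventually_inv_mul_le_of_quadratic_decrease
    (d := fun t => M.valueFrom (detPolicy astar) μ - M.valueFrom (softmaxPolicy (θ t)) μ)
    (fun t _ => sub_pos.2 (FiniteMDP.valueFrom_lt hopt hgap (softmaxPolicy_pos (θ t)) μ))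
    (by positivity) hε'0 hcε hcK
    (fun t ht hd => by
      simp only [hruns t ht]
      exact FiniteMDP.sub_quadratic_le_suboptimality_gradient_step hr hopt hgap μ (θ t)
        (hη t ht).1.le (hη t ht).2 rfl (hd.trans (min_le_left _ _)))
    (fun t ht hd => by
      simp only [hruns t ht]
      exact hε' (θ t) (η t) (hη t ht).1.le (hη t ht).2 hd)
  refine ⟨T, hT, fun t ht => le_of_eq_of_le ?_ (h t ht)⟩
  have ht0 : (0 : ℝ) < t := by exact_mod_cast lt_of_lt_of_le one_pos (hT.trans ht)
  have h1 : 1 - M.γ = H⁻¹ := (inv_inv _).symm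
  rw [h1]
  field_simp
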